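/- Let $B=(B_t)_{t\ge 0}$ be a standard Brownian motion under a probability measure $Q$, and for real $\nu$ and $t\ge 0$ put $$A_t^{(\nu)}=\int_0^t e^{2(\nu w+B_w)}\,dw .$$ Fix real numbers $a>0$ and $x>0$. Then $A_x^{(\nu)}$ is $Q$-integrable for every real $\nu$, and so is $(A_x^{(\nu)}-a)^+$; put $L(x,\nu)=E^Q\big[(A_x^{(\nu)}-a)^+\big]$ for real $\nu$. For every complex $\nu$ the random variable $(A_x^{(0)}-a)^+e^{\nu B_x}$ is $Q$-integrable, and the function $$\nu\longmapsto L(x,\nu):=e^{-\frac{x}{2}\nu^2}\,E^Q\Big[(A_x^{(0)}-a)^+\,e^{\nu B_x}\Big]\qquad(\nu\in\mathbb C)$$ agrees with $E^Q\big[(A_x^{(\nu)}-a)^+\big]$ for all real $\nu$ and is analytic at every point of the complex plane. Moreover, for every complex $\nu$, $$|L(x,\nu)|\le e^{\frac{x}{2}(\operatorname{Im}\nu)^2}\,E^Q\big[A_x^{(\operatorname{Re}\nu)}\big].$$ -/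

import Mathlib

open MeasureTheory ProbabilityTheory
open scoped NNReal

/-- Yor's process with drift `ν` driven by `B`, at time `t`:
`A_t^{(ν)} = ∫_0^t exp (2 (ν w + B_w)) dw`, path by path. -/
noncomputable def yorProcess {Ω : Type*} (B : ℝ≥0 → Ω → ℝ) (ν t : ℝ) (ω : Ω) : ℝ :=
  ∫ w in (0 : ℝ)..t, Real.exp (2 * (ν * w + B w.toNNReal ω))

/-- The payoff `(A_x^{(ν)} - a)^+`. -/
noncomputable def yorPayoff {Ω : Type*} (B : ℝ≥0 → Ω → ℝ) (a x ν : ℝ) (ω : Ω) : ℝ :=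
  max (yorProcess B ν x ω - a) 0

/-- `L(x, ν) = E[(A_x^{(ν)} - a)^+]` for real drift `ν`. -/
noncomputable def yorL {Ω : Type*} [MeasurableSpace Ω] (Q : Measure Ω) (B : ℝ≥0 → Ω → ℝ)
    (a x ν : ℝ) : ℝ :=
  ∫ ω, yorPayoff B a x ν ω ∂Q

/-- The random variable `(A_x^{(0)} - a)^+ exp (ν B_x)` for complex `ν`. -/
noncomputable def girsanovIntegrand {Ω : Type*} (B : ℝ≥0 → Ω → ℝ) (a x : ℝ) (ν : ℂ) (ω : Ω) : ℂ :=
  (yorPayoff B a x 0 ω : ℂ) * Complex.exp (ν * (B x.toNNReal ω : ℂ))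

/-- The Girsanov representation `E[(A_x^{(0)} - a)^+ exp (ν B_x)] exp (-x ν² / 2)`, for
complex `ν`. -/
noncomputable def girsanovL {Ω : Type*} [MeasurableSpace Ω] (Q : Measure Ω) (B : ℝ≥0 → Ω → ℝ)
    (a x : ℝ) (ν : ℂ) : ℂ :=
  (∫ ω, girsanovIntegrand B a x ν ω ∂Q) * Complex.exp (-((x : ℂ) / 2) * ν ^ 2)

/-!
Girsanov's theorem is needed only on `[0, x]` and for a deterministic drift, where it follows from
the Brownian bridge. The process `b_t = B_t - (t / x) B_x` is Gaussian and uncorrelated with `B_x`,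
hence independent of it (`IsPreBrownianReal.indepFun_bridge`). Weighting by
`exp (ν B_x - x ν² / 2)` therefore leaves the law of `b` alone and translates the Gaussian variable
`B_x` by `ν x` (`lintegral_mul_exp_gaussianReal`), which adds `ν t` to `B_t = b_t + (t / x) B_x`.
This gives the Cameron–Martin formula
`IsPreBrownianReal.lintegral_mul_exp_eq_lintegral_add_drift` for measurable functionals of
countably many coordinates.

The map `(ω, w) ↦ B_w ω` need not be jointly measurable, since the paths are continuous only almost
surely and each `B_w` is only almost everywhere measurable. Almost surely, though, the path is
recovered from its values on a countable time grid by the jointly measurable map `gridExtend`. Thus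
`A_x^{(ν)}` is almost surely a measurable function of grid values. Fubini's theorem then gives
`integrable_yorProcess`, and the Cameron–Martin formula gives `yorL_eq_integral_mul_exp`, the
agreement for real `ν`.

For complex `ν`, the expectation `E[(A_x^{(0)} - a)^+ exp (ν B_x)]` is the complex moment generating
function of `B_x` under the finite measure with density `(A_x^{(0)} - a)^+`. Its exponential moments
are all finite, by the real case, so it is entire (`analyticAt_integral_girsanovIntegrand`). Taking
absolute values inside the expectation replaces `ν` by `Re ν`, and
`|exp (-x ν² / 2)| = exp (-x (Re ν)² / 2) exp (x (Im ν)² / 2)`; with `(A - a)^+ ≤ A` for `a > 0`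
this is the majorization.
-/

open Filter Topology

/-! ### Cameron–Martin formula on countably many times -/

/-- Tilting a centred Gaussian measure of variance `v` by `exp (ν y - v ν² / 2)` translates it
by `ν v`. -/
lemma lintegral_mul_exp_gaussianReal {v : ℝ≥0} (hv : v ≠ 0) (ν : ℝ) {g : ℝ → ENNReal}
    (hg : Measurable g) :
    ∫⁻ y, g y * ENNReal.ofReal (Real.exp (ν * y - v / 2 * ν ^ 2)) ∂gaussianReal 0 v =
      ∫⁻ y, g (y + ν * v) ∂gaussianReal 0 v := by
  have hshift : ∫⁻ y, g (y + ν * v) ∂gaussianReal 0 v = ∫⁻ y, g y ∂gaussianReal (ν * v) v := by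
    rw [← zero_add (ν * (v : ℝ)), ← gaussianReal_map_add_const, lintegral_map hg (by fun_prop),
      zero_add]
  rw [hshift, gaussianReal_of_var_ne_zero _ hv, gaussianReal_of_var_ne_zero _ hv,
    lintegral_withDensity_eq_lintegral_mul _ (measurable_gaussianPDF _ _) (by fun_prop),
    lintegral_withDensity_eq_lintegral_mul _ (measurable_gaussianPDF _ _) hg]
  refine lintegral_congr fun y ↦ ?_
  have hv' : (v : ℝ) ≠ 0 := by exact_mod_cast hv
  have key : gaussianPDFReal 0 v y * Real.exp (ν * y - v / 2 * ν ^ 2) =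
      gaussianPDFReal (ν * v) v y := by
    simp only [gaussianPDFReal_def]
    rw [mul_assoc, ← Real.exp_add]
    congr 2
    field_simp
    ring
  simp only [Pi.mul_apply, gaussianPDF_def]
  rw [← key, ENNReal.ofReal_mul (gaussianPDFReal_nonneg _ _ _)]
  ring

/-- The Brownian bridge on `[0, x]` is independent of the endpoint `B x`. After time `x` the
process `B t - B x` takes the place of the bridge. -/
lemma ProbabilityTheory.IsPreBrownianReal.indepFun_bridge {Ω ι : Type*} [MeasurableSpace Ω]
    {Q : Measure Ω} {B : ℝ≥0 → Ω → ℝ} (hB : IsPreBrownianReal B Q) (p : ι → ℝ≥0) {x : ℝ≥0}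
    (hx : x ≠ 0) :
    IndepFun (fun ω i ↦ B (p i) ω - min (p i) x / x * B x ω) (B x) Q := by
  have hx' : (x : ℝ) ≠ 0 := by exact_mod_cast hx
  have hprob := hB.isGaussianProcess.isProbabilityMeasure
  have hLp t : MemLp (B t) 2 Q := (hB.isGaussianProcess.hasGaussianLaw_eval t).memLp_two
  have mB t := hB.aemeasurable t
  have h : IndepFun (fun ω i ↦ B (p i) ω - min (p i) x / x * B x ω)
      (fun ω (_ : Unit) ↦ B x ω) Q := by
    apply IsGaussianProcess.indepFun_of_covariance_eq_zero
    · apply hB.isGaussianProcess.of_isGaussianProcess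
      rintro (i | _)
      · exact ⟨{p i, x},
          { toFun f := f ⟨p i, by simp⟩ - min (p i) x / x * f ⟨x, by simp⟩
            map_add' f g := by simp; ring
            map_smul' c f := by simp; ring }, by simp⟩
      · exact ⟨{x},
          { toFun f := f ⟨x, by simp⟩
            map_add' f g := by simp
            map_smul' c f := by simp }, by simp⟩
    · intro i
      fun_prop
    · intro _
      fun_prop
    · intro i _
      rw [covariance_fun_sub_left (hLp _) ((hLp x).const_mul _) (hLp x),
        covariance_const_mul_left, hB.covariance_eval, hB.covariance_eval]
      simp [hx']
  exact h.comp measurable_id (measurable_pi_apply ())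

/-- **Cameron–Martin formula**: weighting by `exp (ν B_x - x ν² / 2)` adds the drift `ν (t ∧ x)`
to a Brownian motion, as far as functionals of countably many times `p i` are concerned. -/
lemma ProbabilityTheory.IsPreBrownianReal.lintegral_mul_exp_eq_lintegral_add_drift
    {Ω ι : Type*} [MeasurableSpace Ω] [Countable ι]
    {Q : Measure Ω} {B : ℝ≥0 → Ω → ℝ} (hB : IsPreBrownianReal B Q) (p : ι → ℝ≥0) {x : ℝ≥0}
    (hx : x ≠ 0) (ν : ℝ) {g : (ι → ℝ) → ENNReal} (hg : Measurable g) :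
    ∫⁻ ω, g (fun i ↦ B (p i) ω) * ENNReal.ofReal (Real.exp (ν * B x ω - x / 2 * ν ^ 2)) ∂Q =
      ∫⁻ ω, g (fun i ↦ B (p i) ω + ν * min (p i) x) ∂Q := by
  have hx' : (x : ℝ) ≠ 0 := by exact_mod_cast hx
  have hprob := hB.isGaussianProcess.isProbabilityMeasure
  have mB t := hB.aemeasurable t
  set b : Ω → ι → ℝ := fun ω i ↦ B (p i) ω - min (p i) x / x * B x ω with hb
  have mb : AEMeasurable b Q := aemeasurable_pi_lambda _ fun i ↦ by fun_prop
  set Φ : (ι → ℝ) × ℝ → ι → ℝ := fun q i ↦ q.1 i + min (p i) x / x * q.2 with hΦ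
  have mΦ : Measurable Φ := by fun_prop
  have hlaw : Q.map (fun ω ↦ (b ω, B x ω)) = (Q.map b).prod (gaussianReal 0 x) := by
    rw [(indepFun_iff_map_prod_eq_prod_map_map mb (mB x)).1 (hB.indepFun_bridge p hx),
      (hB.hasLaw_eval x).map_eq]
  have : IsProbabilityMeasure (Q.map b) := Measure.isProbabilityMeasure_map mb
  have hjoint (G : (ι → ℝ) × ℝ → ENNReal) (hG : Measurable G) :
      ∫⁻ ω, G (b ω, B x ω) ∂Q = ∫⁻ c, ∫⁻ y, G (c, y) ∂gaussianReal 0 x ∂Q.map b := by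
    rw [← lintegral_prod _ hG.aemeasurable, ← hlaw,
      lintegral_map' hG.aemeasurable (mb.prodMk (mB x))]
  calc _ = ∫⁻ ω, (fun q : (ι → ℝ) × ℝ ↦
        g (Φ q) * ENNReal.ofReal (Real.exp (ν * q.2 - x / 2 * ν ^ 2))) (b ω, B x ω) ∂Q := by
        simp [hΦ, hb]
    _ = ∫⁻ c, ∫⁻ y, g (Φ (c, y + ν * x)) ∂gaussianReal 0 x ∂Q.map b := by
        refine (hjoint (fun q ↦ g (Φ q) *
          ENNReal.ofReal (Real.exp (ν * q.2 - x / 2 * ν ^ 2))) (by fun_prop)).trans ?_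
        refine lintegral_congr fun c ↦ ?_
        exact lintegral_mul_exp_gaussianReal hx ν (g := fun y ↦ g (Φ (c, y))) (by fun_prop)
    _ = ∫⁻ ω, (fun q : (ι → ℝ) × ℝ ↦ g (Φ (q.1, q.2 + ν * x))) (b ω, B x ω) ∂Q := by
        exact (hjoint (fun q ↦ g (Φ (q.1, q.2 + ν * x))) (by fun_prop)).symm
    _ = _ := by
        refine lintegral_congr fun ω ↦ ?_
        refine congrArg g (funext fun i ↦ ?_)
        simp only [hΦ, hb]
        field_simp
        ring

/-! ### Path functionals through countably many times -/

/-- The time grid `k / (n + 1)`, indexed by `(n, k)`. -/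
noncomputable def gridTime (p : ℕ × ℕ) : ℝ≥0 := p.2 / (p.1 + 1)

/-- The value at `w` of the path with grid values `v`, read off along the grid points
`⌊(n + 1) w⌋ / (n + 1)`. It is jointly measurable in `(v, w)`, and it is the path itself when the
path is continuous. -/
noncomputable def gridExtend (v : ℕ × ℕ → ℝ) (w : ℝ) : ℝ :=
  limsup (fun n : ℕ ↦ v (n, ⌊w * ((n + 1 : ℕ) : ℝ)⌋₊)) atTop

lemma measurable_gridExtend :
    Measurable fun q : (ℕ × ℕ → ℝ) × ℝ ↦ gridExtend q.1 q.2 := by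
  refine Measurable.limsup fun n ↦ ?_
  have h : Measurable fun q : (ℕ × ℕ → ℝ) × ℕ ↦ q.1 (n, q.2) :=
    measurable_from_prod_countable_left fun k ↦ measurable_pi_apply (n, k)
  exact h.comp (measurable_fst.prodMk
    (Nat.measurable_floor.comp (measurable_snd.mul_const _)))

lemma gridExtend_of_continuous {f : ℝ≥0 → ℝ} (hf : Continuous f) {w : ℝ} (hw : 0 ≤ w) :
    gridExtend (fun p ↦ f (gridTime p)) w = f w.toNNReal := by
  refine Tendsto.limsup_eq ((hf.tendsto _).comp ?_)
  rw [← NNReal.tendsto_coe, Real.coe_toNNReal _ hw]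
  refine ((tendsto_nat_floor_mul_div_atTop hw).comp (tendsto_natCast_atTop_atTop.comp
    (tendsto_add_atTop_nat 1))).congr fun n ↦ ?_
  simp [gridTime]

/-- The functional `∫_0^x exp (2 f(w)) dw` of a path `f`, as a function of its grid values. -/
noncomputable def gridYor (x : ℝ) (v : ℕ × ℕ → ℝ) : ℝ :=
  ∫ w in (0 : ℝ)..x, Real.exp (2 * gridExtend v w)

lemma measurable_gridYor (x : ℝ) : Measurable (gridYor x) := by
  have h : StronglyMeasurable fun q : (ℕ × ℕ → ℝ) × ℝ ↦ Real.exp (2 * gridExtend q.1 q.2) :=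
    (Real.measurable_exp.comp (measurable_gridExtend.const_mul 2)).stronglyMeasurable
  exact (h.integral_prod_right.sub h.integral_prod_right).measurable

lemma gridYor_of_continuous {f : ℝ≥0 → ℝ} (hf : Continuous f) {x : ℝ} (hx : 0 ≤ x) :
    gridYor x (fun p ↦ f (gridTime p)) = ∫ w in (0 : ℝ)..x, Real.exp (2 * f w.toNNReal) := by
  refine intervalIntegral.integral_congr fun w hw ↦ ?_
  rw [Set.uIcc_of_le hx] at hw
  simp only [gridExtend_of_continuous hf hw.1]

/-! ### Yor's process -/

section Yor

variable {Ω : Type*} {B : ℝ≥0 → Ω → ℝ}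

lemma yorProcess_eq_gridYor {ω : Ω} (h : Continuous (B · ω)) {x : ℝ} (hx : 0 ≤ x) (ν : ℝ) :
    yorProcess B ν x ω =
      gridYor x fun p ↦ B (gridTime p) ω + ν * (min (gridTime p) x.toNNReal : ℝ≥0) := by
  rw [gridYor_of_continuous (f := fun t ↦ B t ω + ν * (min t x.toNNReal : ℝ≥0)) (by fun_prop) hx]
  refine intervalIntegral.integral_congr fun w hw ↦ ?_
  rw [Set.uIcc_of_le hx] at hw
  simp only [min_eq_left (Real.toNNReal_le_toNNReal hw.2), Real.coe_toNNReal _ hw.1]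
  ring_nf

lemma yorProcess_zero_eq_gridYor {ω : Ω} (h : Continuous (B · ω)) {x : ℝ} (hx : 0 ≤ x) :
    yorProcess B 0 x ω = gridYor x fun p ↦ B (gridTime p) ω := by
  simpa using yorProcess_eq_gridYor h hx 0

lemma yorProcess_nonneg (B : ℝ≥0 → Ω → ℝ) (ν : ℝ) {x : ℝ} (hx : 0 ≤ x) (ω : Ω) :
    0 ≤ yorProcess B ν x ω :=
  intervalIntegral.integral_nonneg hx fun _ _ ↦ (Real.exp_pos _).le

lemma yorPayoff_nonneg (B : ℝ≥0 → Ω → ℝ) (a x ν : ℝ) (ω : Ω) : 0 ≤ yorPayoff B a x ν ω :=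
  le_max_right _ _

lemma yorPayoff_le_yorProcess (B : ℝ≥0 → Ω → ℝ) {a x : ℝ} (ha : 0 ≤ a) (hx : 0 ≤ x) (ν : ℝ)
    (ω : Ω) : yorPayoff B a x ν ω ≤ yorProcess B ν x ω :=
  max_le (by linarith) (yorProcess_nonneg B ν hx ω)

lemma norm_girsanovIntegrand (B : ℝ≥0 → Ω → ℝ) (a x : ℝ) (ν : ℂ) (ω : Ω) :
    ‖girsanovIntegrand B a x ν ω‖ =
      yorPayoff B a x 0 ω * Real.exp (ν.re * B x.toNNReal ω) := by
  simp [girsanovIntegrand, Complex.norm_exp, abs_of_nonneg (yorPayoff_nonneg B a x 0 ω)]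

variable [MeasurableSpace Ω] {Q : Measure Ω}

lemma aemeasurable_grid (hB : IsPreBrownianReal B Q) :
    AEMeasurable (fun ω (p : ℕ × ℕ) ↦ B (gridTime p) ω) Q :=
  aemeasurable_pi_lambda _ fun _ ↦ hB.aemeasurable _

/-- `E[exp (2 (c + B_t))] = exp (2 c + 2 t)`. -/
lemma integral_exp_two_mul_add (hB : IsPreBrownianReal B Q) (c : ℝ) (t : ℝ≥0) :
    ∫ ω, Real.exp (2 * (c + B t ω)) ∂Q = Real.exp (2 * c + 2 * t) := by
  have h := mgf_gaussianReal (hB.hasLaw_eval t).map_eq 2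
  simp only [mgf] at h
  simp_rw [mul_add, Real.exp_add, integral_const_mul, h]
  congr 2
  ring

lemma integrable_exp_mul (hB : IsPreBrownianReal B Q) (c : ℝ) (t : ℝ≥0) :
    Integrable (fun ω ↦ Real.exp (c * B t ω)) Q := by
  have := hB.isGaussianProcess.isProbabilityMeasure
  rw [← mgf_pos_iff, mgf_gaussianReal (hB.hasLaw_eval t).map_eq]
  exact Real.exp_pos _

/-- By Fubini, `A_x^{(ν)}` is integrable because `∫_0^x exp (2 (ν + 1) w) dw` is finite. Fubini is
applied to the jointly measurable version of `B` given by `gridExtend`. -/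
lemma integrable_yorProcess (hB : IsBrownianReal B Q) {x : ℝ} (hx : 0 ≤ x) (ν : ℝ) :
    Integrable (yorProcess B ν x) Q := by
  have hprob := hB.isGaussianProcess.isProbabilityMeasure
  obtain ⟨V, mV, hV⟩ := aemeasurable_grid hB.toIsPreBrownianReal
  set F : Ω × ℝ → ℝ := fun q ↦ Real.exp (2 * (ν * q.2 + gridExtend (V q.1) q.2)) with hF
  have mF : Measurable F := by
    have hVq : Measurable fun q : Ω × ℝ ↦ (V q.1, q.2) :=
      (mV.comp measurable_fst).prodMk measurable_snd
    have h := measurable_gridExtend.comp hVq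
    exact Real.measurable_exp.comp (((measurable_snd.const_mul ν).add h).const_mul 2)
  have hFB : ∀ᵐ ω ∂Q, ∀ w, 0 ≤ w → F (ω, w) = Real.exp (2 * (ν * w + B w.toNNReal ω)) := by
    filter_upwards [hB.cont, hV] with ω hc hω w hw
    simp only [hF, ← hω, gridExtend_of_continuous hc hw]
  have hint : Integrable F (Q.prod (volume.restrict (Set.Ioc 0 x))) := by
    rw [integrable_prod_iff' mF.aestronglyMeasurable]
    constructor
    · filter_upwards [ae_restrict_mem measurableSet_Ioc] with w hw
      refine ((integrable_exp_mul hB.toIsPreBrownianReal 2 w.toNNReal).const_mul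
        (Real.exp (2 * (ν * w)))).congr ?_
      filter_upwards [hFB] with ω hω
      rw [hω w hw.1.le, mul_add, Real.exp_add]
    · have hcont : Continuous fun w : ℝ ↦ Real.exp (2 * (ν * w) + 2 * w) := by fun_prop
      refine (hcont.integrableOn_Ioc (a := 0) (b := x)).congr ?_
      filter_upwards [ae_restrict_mem measurableSet_Ioc] with w hw
      have h := integral_exp_two_mul_add hB.toIsPreBrownianReal (ν * w) w.toNNReal
      rw [Real.coe_toNNReal _ hw.1.le] at h
      rw [← h]
      refine integral_congr_ae ?_
      filter_upwards [hFB] with ω hω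
      exact ((Real.norm_of_nonneg (Real.exp_pos _).le).trans (hω w hw.1.le)).symm
  refine hint.integral_prod_left.congr ?_
  filter_upwards [hFB] with ω hω
  rw [yorProcess, intervalIntegral.integral_of_le hx]
  exact setIntegral_congr_fun measurableSet_Ioc fun w hw ↦ hω w hw.1.le

lemma integrable_yorPayoff (hB : IsBrownianReal B Q) (a : ℝ) {x : ℝ} (hx : 0 ≤ x) (ν : ℝ) :
    Integrable (yorPayoff B a x ν) Q := by
  have := hB.isGaussianProcess.isProbabilityMeasure
  exact ((integrable_yorProcess hB hx ν).sub (integrable_const a)).pos_part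

/-- **Girsanov's formula** for the payoff, in terms of Lebesgue integrals. -/
lemma lintegral_yorPayoff_mul_exp (hB : IsBrownianReal B Q) (a : ℝ) {x : ℝ} (hx : 0 < x)
    (ν : ℝ) :
    ∫⁻ ω, ENNReal.ofReal (yorPayoff B a x 0 ω *
        Real.exp (ν * B x.toNNReal ω - x / 2 * ν ^ 2)) ∂Q =
      ∫⁻ ω, ENNReal.ofReal (yorPayoff B a x ν ω) ∂Q := by
  have mg : Measurable fun v ↦ ENNReal.ofReal (max (gridYor x v - a) 0) := by
    have := measurable_gridYor x
    fun_prop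
  have h := hB.toIsPreBrownianReal.lintegral_mul_exp_eq_lintegral_add_drift gridTime
    (x := x.toNNReal) (by simpa using hx) ν mg
  rw [Real.coe_toNNReal _ hx.le] at h
  refine Eq.trans (lintegral_congr_ae ?_) (h.trans (lintegral_congr_ae ?_))
  · filter_upwards [hB.cont] with ω hc
    rw [ENNReal.ofReal_mul (yorPayoff_nonneg ..), yorPayoff, yorProcess_zero_eq_gridYor hc hx.le]
  · filter_upwards [hB.cont] with ω hc
    rw [yorPayoff, yorProcess_eq_gridYor hc hx.le ν]

lemma integrable_yorPayoff_mul_exp_sub (hB : IsBrownianReal B Q) (a : ℝ) {x : ℝ} (hx : 0 < x)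
    (ν : ℝ) :
    Integrable (fun ω ↦ yorPayoff B a x 0 ω *
        Real.exp (ν * B x.toNNReal ω - x / 2 * ν ^ 2)) Q := by
  have mB := hB.toIsPreBrownianReal.aemeasurable x.toNNReal
  have mP := (integrable_yorPayoff hB a hx.le 0).aestronglyMeasurable.aemeasurable
  refine ⟨AEMeasurable.aestronglyMeasurable (by fun_prop), ?_⟩
  rw [hasFiniteIntegral_iff_ofReal
    (ae_of_all _ fun ω ↦ mul_nonneg (yorPayoff_nonneg ..) (Real.exp_pos _).le),
    lintegral_yorPayoff_mul_exp hB a hx ν,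
    ← hasFiniteIntegral_iff_ofReal (ae_of_all _ fun ω ↦ yorPayoff_nonneg ..)]
  exact (integrable_yorPayoff hB a hx.le ν).2

lemma integrable_yorPayoff_mul_exp (hB : IsBrownianReal B Q) (a : ℝ) {x : ℝ} (hx : 0 < x)
    (ν : ℝ) :
    Integrable (fun ω ↦ yorPayoff B a x 0 ω * Real.exp (ν * B x.toNNReal ω)) Q := by
  refine ((integrable_yorPayoff_mul_exp_sub hB a hx ν).mul_const
    (Real.exp (x / 2 * ν ^ 2))).congr (ae_of_all _ fun ω ↦ ?_)
  simp only [mul_assoc, ← Real.exp_add, sub_add_cancel]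

/-- **Girsanov's formula** for the payoff. -/
lemma yorL_eq_integral_mul_exp (hB : IsBrownianReal B Q) (a : ℝ) {x : ℝ} (hx : 0 < x) (ν : ℝ) :
    (∫ ω, yorPayoff B a x 0 ω * Real.exp (ν * B x.toNNReal ω) ∂Q) * Real.exp (-(x / 2) * ν ^ 2) =
      yorL Q B a x ν := by
  rw [yorL, integral_eq_lintegral_of_nonneg_ae (ae_of_all _ fun ω ↦ yorPayoff_nonneg ..)
    (integrable_yorPayoff hB a hx.le ν).aestronglyMeasurable,
    ← lintegral_yorPayoff_mul_exp hB a hx ν, ← integral_eq_lintegral_of_nonneg_ae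
    (ae_of_all _ fun ω ↦ mul_nonneg (yorPayoff_nonneg ..) (Real.exp_pos _).le)
    (integrable_yorPayoff_mul_exp_sub hB a hx ν).aestronglyMeasurable, ← integral_mul_const]
  congr with ω
  rw [mul_assoc, ← Real.exp_add]
  ring_nf

/-! ### The complex extension -/

lemma integrable_girsanovIntegrand (hB : IsBrownianReal B Q) (a : ℝ) {x : ℝ} (hx : 0 < x)
    (ν : ℂ) : Integrable (girsanovIntegrand B a x ν) Q := by
  have mB := hB.toIsPreBrownianReal.aemeasurable x.toNNReal
  have mP := (integrable_yorPayoff hB a hx.le 0).aestronglyMeasurable.aemeasurable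
  refine (integrable_yorPayoff_mul_exp hB a hx ν.re).mono' ?_
    (ae_of_all _ fun ω ↦ (norm_girsanovIntegrand B a x ν ω).le)
  unfold girsanovIntegrand
  exact AEMeasurable.aestronglyMeasurable (by fun_prop)

lemma integral_girsanovIntegrand_ofReal (a x ν : ℝ) :
    ∫ ω, girsanovIntegrand B a x (ν : ℂ) ω ∂Q =
      ((∫ ω, yorPayoff B a x 0 ω * Real.exp (ν * B x.toNNReal ω) ∂Q : ℝ) : ℂ) := by
  rw [← integral_complex_ofReal]
  simp [girsanovIntegrand]

/-- `ν ↦ E[(A_x^{(0)} - a)^+ exp (ν B_x)]` is the complex moment generating function of `B_x` under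
the measure of density `(A_x^{(0)} - a)^+`, which has exponential moments of all orders. -/
lemma analyticAt_integral_girsanovIntegrand (hB : IsBrownianReal B Q) (a : ℝ) {x : ℝ}
    (hx : 0 < x) (ν : ℂ) :
    AnalyticAt ℂ (fun ν ↦ ∫ ω, girsanovIntegrand B a x ν ω ∂Q) ν := by
  have mP := (integrable_yorPayoff hB a hx.le 0).aestronglyMeasurable.aemeasurable
  set μ := Q.withDensity fun ω ↦ ENNReal.ofReal (yorPayoff B a x 0 ω) with hμ
  have hmgf : (fun ν ↦ ∫ ω, girsanovIntegrand B a x ν ω ∂Q) =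
      complexMGF (B x.toNNReal) μ := by
    ext z
    rw [complexMGF, hμ, integral_withDensity_eq_integral_toReal_smul₀ mP.ennreal_ofReal
      (ae_of_all _ fun _ ↦ ENNReal.ofReal_lt_top)]
    congr with ω
    rw [ENNReal.toReal_ofReal (yorPayoff_nonneg ..), Complex.real_smul, girsanovIntegrand]
  have huniv : integrableExpSet (B x.toNNReal) μ = Set.univ := by
    refine Set.eq_univ_of_forall fun t ↦ ?_
    rw [integrableExpSet, Set.mem_ofPred_eq, hμ,
      integrable_withDensity_iff_integrable_smul₀' mP.ennreal_ofReal
      (ae_of_all _ fun _ ↦ ENNReal.ofReal_lt_top)]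
    refine (integrable_yorPayoff_mul_exp hB a hx t).congr (ae_of_all _ fun ω ↦ ?_)
    simp only [ENNReal.toReal_ofReal (yorPayoff_nonneg ..), smul_eq_mul]
  rw [hmgf]
  exact analyticAt_complexMGF (by simp [huniv])

lemma norm_girsanovL_le (hB : IsBrownianReal B Q) (a : ℝ) {x : ℝ} (hx : 0 < x) (ν : ℂ) :
    ‖girsanovL Q B a x ν‖ ≤ Real.exp (x / 2 * ν.im ^ 2) * yorL Q B a x ν.re := by
  have hre : (-((x : ℂ) / 2) * ν ^ 2).re = -(x / 2) * ν.re ^ 2 + x / 2 * ν.im ^ 2 := by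
    have h2 : ((x : ℂ) / 2) = ((x / 2 : ℝ) : ℂ) := by push_cast; rfl
    rw [h2, ← Complex.ofReal_neg, Complex.re_ofReal_mul, sq ν, Complex.mul_re]
    ring
  rw [girsanovL, norm_mul, Complex.norm_exp, hre, Real.exp_add, ← mul_assoc, mul_comm,
    ← yorL_eq_integral_mul_exp hB a hx]
  gcongr
  refine (norm_integral_le_integral_norm _).trans_eq ?_
  simp_rw [norm_girsanovIntegrand]

end Yor

theorem mainTheorem4 {Ω : Type*} [MeasurableSpace Ω] (Q : Measure Ω) [IsProbabilityMeasure Q]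
    (B : ℝ≥0 → Ω → ℝ) (hB : IsBrownianReal B Q) (a x : ℝ) (ha : 0 < a) (hx : 0 < x) :
    -- all the expectations involved are finite
    (∀ ν : ℝ, Integrable (yorProcess B ν x) Q) ∧
    (∀ ν : ℝ, Integrable (yorPayoff B a x ν) Q) ∧
    (∀ ν : ℂ, Integrable (girsanovIntegrand B a x ν) Q) ∧
    -- the Girsanov representation extends `L(x, ·)` from the real line
    (∀ ν : ℝ, girsanovL Q B a x (ν : ℂ) = ((yorL Q B a x ν : ℝ) : ℂ)) ∧
    -- it is analytic at each point of the complex plane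
    (∀ ν : ℂ, AnalyticAt ℂ (girsanovL Q B a x) ν) ∧
    -- the majorization
    (∀ ν : ℂ, ‖girsanovL Q B a x ν‖ ≤
      Real.exp (x / 2 * ν.im ^ 2) * ∫ ω, yorProcess B ν.re x ω ∂Q) := by

  refine ⟨integrable_yorProcess hB hx.le, integrable_yorPayoff hB a hx.le,
    integrable_girsanovIntegrand hB a hx, fun ν ↦ ?_, fun ν ↦ ?_, fun ν ↦ ?_⟩
  · rw [← yorL_eq_integral_mul_exp hB a hx, girsanovL, integral_girsanovIntegrand_ofReal]
    push_cast
    rfl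
  · exact (analyticAt_integral_girsanovIntegrand hB a hx ν).mul (by fun_prop)
  · refine (norm_girsanovL_le hB a hx ν).trans ?_
    gcongr
    exact integral_mono (integrable_yorPayoff hB a hx.le _) (integrable_yorProcess hB hx.le _)
      (yorPayoff_le_yorProcess B ha.le hx.le _)
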